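/- **Extended Bernstein's theorem.** *Cones.* A cone $C$ is an $\mathbb{R}_+$-semimodule with a norm $\|\cdot\|:C\to\mathbb{R}_+$ such that $x+y=x+y'\Rightarrow y=y'$, $\|\alpha x\|=\alpha\|x\|$, $\|x+x'\|\le\|x\|+\|x'\|$, $\|x\|=0\Rightarrow x=0$, and $\|x\|\le\|x+x'\|$. It is partially ordered by: $x\le y$ iff $y=x+z$ for some $z\in C$ (then $z$ is unique and written $y-x$). Let $\mathcal{B}C=\{x:\|x\|\le 1\}$. The cone is *directed-complete* if every nonempty directed subset of $\mathcal{B}C$ has a least upper bound, lying in $\mathcal{B}C$; it is a *lattice cone* if any two elements have a least upper bound. *Pre-stable functions.* For $x\in\mathcal{B}C$ let $\mathcal{B}C_x^n$ be the set of $\vec u=(u_1,\dots,u_n)\in C^n$ with $\|x+\sum_i u_i\|\le 1$. For $f:\mathcal{B}C\to D$, $x\in \mathcal BC$ and $\vec u\in\mathcal{B}C_x^n$, put $$\Delta^n_{+}f(x\mid\vec u)=\sum_{I\subseteq\{1,\dots,n\},\ n-|I|\text{ even}} f\Big(x+\sum_{i\in I}u_i\Big),\qquad \Delta^n_{-}f(x\mid\vec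 u)=\sum_{I\subseteq\{1,\dots,n\},\ n-|I|\text{ odd}} f\Big(x+\sum_{i\in I}u_i\Big).$$ The function $f$ is *pre-stable* if $\Delta^n_-f(x\mid\vec u)\le\Delta^n_+f(x\mid\vec u)$ for all $n\in\mathbb{N}$, $x\in\mathcal{B}C$, $\vec u\in\mathcal{B}C_x^n$; then $\Delta^nf=\Delta^n_+f-\Delta^n_-f$. *Derivatives.* A partition of $u\in C$ is a finite multiset of elements of $C$ with sum $u$. For $\vec u\in\mathcal{B}C_x^n$ let $$D^nf(x\mid\vec u)=\inf_{\pi_1,\dots,\pi_n}\ \sum_{y_1\in\pi_1}\cdots\sum_{y_n\in\pi_n}\Delta^nf(x\mid y_1,\dots,y_n),$$ where each $\pi_i$ ranges over the partitions of $u_i$ (sums are taken with multiplicity). For $\|x\|<1$, extend $D^nf(x\mid\cdot)$ to all of $C^n$ by $D^nf(x\mid\vec u)=r^{-n}D^nf(x\mid r\vec u)$, with any $r>0$ such that $r\vec u\in\mathcal{B}C_x^n$. Let $$Tf^N(x\mid y)=f(x)+\sum_{k=1}^N\frac1{k!}D^kf(x\mid y,\dots,y),\qquad Tf(x\mid y)=\sup_{N\in\mathbb{N}}Tf^N(x\mid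 y).$$ *Theorem.* Let $C$ and $D$ be directed-complete lattice cones and $f:\mathcal{B}C\to D$ a pre-stable function. Then the infima defining $D^nf(0\mid\vec u)$ for $\vec u\in\mathcal{B}C_0^n$ exist for every $n$, their extension to $C^n$ does not depend on the choice of $r$, and for every $x\in C$ with $\|x\|<1$ the supremum defining $Tf(0\mid x)$ exists and $$f(x)=Tf(0\mid x).$$ -/

import Mathlib

open scoped NNReal Nat

/-- A cone: an `ℝ≥0`-semimodule that is additively cancellative, with an `ℝ≥0`-valued norm that is
homogeneous, subadditive, separating, and monotone for the algebraic order. -/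
class NormedCone (C : Type*) [AddCommMonoid C] [Module ℝ≥0 C] where
  cnorm : C → ℝ≥0
  add_left_cancel' : ∀ x y y' : C, x + y = x + y' → y = y'
  cnorm_smul : ∀ (a : ℝ≥0) (x : C), cnorm (a • x) = a * cnorm x
  cnorm_add_le : ∀ x x' : C, cnorm (x + x') ≤ cnorm x + cnorm x'
  eq_zero_of_cnorm : ∀ x : C, cnorm x = 0 → x = 0
  cnorm_le_add : ∀ x x' : C, cnorm x ≤ cnorm (x + x')

namespace NormedCone

section Order

variable {C : Type*} [AddCommMonoid C] [Module ℝ≥0 C] [NormedCone C]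

theorem cnorm_zero : cnorm (0 : C) = 0 := by
  have h := cnorm_smul (0 : ℝ≥0) (0 : C)
  simpa using h

theorem eq_zero_of_add_eq_zero {x y : C} (h : x + y = 0) : x = 0 := by
  apply eq_zero_of_cnorm
  have h1 := cnorm_le_add x y
  rw [h, cnorm_zero] at h1
  exact le_antisymm h1 bot_le

/-- The order of a cone: `x ≤ y` if and only if `y = x + z` for some `z` in the cone. -/
instance instPartialOrder : PartialOrder C where
  le x y := ∃ z, y = x + z
  le_refl x := ⟨0, (add_zero x).symm⟩
  le_trans x y z := by
    rintro ⟨a, rfl⟩ ⟨b, rfl⟩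
    exact ⟨a + b, add_assoc x a b⟩
  le_antisymm x y := by
    rintro ⟨a, rfl⟩ ⟨b, hb⟩
    have h : a + b = 0 := by
      apply add_left_cancel' x
      rw [add_zero, ← add_assoc]
      exact hb.symm
    rw [eq_zero_of_add_eq_zero h, add_zero]

variable (C)

/-- Every nonempty directed subset of the unit ball has a least upper bound in the cone,
and this bound lies in the unit ball. -/
def IsDirectedComplete : Prop :=
  ∀ S : Set C, S.Nonempty → DirectedOn (· ≤ ·) S → (∀ x ∈ S, cnorm x ≤ 1) →
    ∃ s : C, cnorm s ≤ 1 ∧ IsLUB S s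

/-- Any two elements have a least upper bound. -/
def IsLattice : Prop :=
  ∀ x y : C, ∃ z : C, IsLUB {x, y} z

variable {C}

/-- The difference `a - b`: the unique `z` with `a = b + z` when `b ≤ a` (unspecified otherwise). -/
noncomputable def coneSub (a b : C) : C :=
  Classical.epsilon fun z => a = b + z

/-- The greatest lower bound of a set (unspecified if there is none). -/
noncomputable def coneInf (S : Set C) : C :=
  Classical.epsilon fun d => IsGLB S d

/-- The least upper bound of a set (unspecified if there is none). -/
noncomputable def coneSup (S : Set C) : C :=
  Classical.epsilon fun d => IsLUB S d

/-- The unit ball of the `n`-local cone at `x`: the tuples `u` such that `x + ∑ i, u i` is in the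
unit ball. (As the norm is monotone and homogeneous, these are exactly the `u` for which
the infimum of the `1 / r`, over `r > 0` with `x + r • ∑ i, u i` in the unit ball, is at most 1.) -/
def localBall (n : ℕ) (x : C) : Set (Fin n → C) :=
  {u | cnorm (x + ∑ i, u i) ≤ 1}

/-- The tuples `(π 1, …, π n)` of finite multisets such that each `π i` is a partition of `u i`,
that is, has sum `u i`. -/
def parts {n : ℕ} (u : Fin n → C) : Set (Fin n → Multiset C) :=
  {π | ∀ i, (π i).sum = u i}

end Order

section Functions

variable {C D : Type*} [AddCommMonoid C] [Module ℝ≥0 C] [NormedCone C]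
  [AddCommMonoid D] [Module ℝ≥0 D] [NormedCone D]

/-- Positive part of the `n`-th difference: the sum of `f (x + ∑ i ∈ I, u i)` over the subsets `I`
of the index set with `n - card I` even. -/
def diffPlus {n : ℕ} (f : C → D) (x : C) (u : Fin n → C) : D :=
  ∑ I : Finset (Fin n) with Even (n - I.card), f (x + ∑ i ∈ I, u i)

/-- Negative part of the `n`-th difference: the same with `n - card I` odd. -/
def diffMinus {n : ℕ} (f : C → D) (x : C) (u : Fin n → C) : D :=
  ∑ I : Finset (Fin n) with Odd (n - I.card), f (x + ∑ i ∈ I, u i)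

/-- `f`, as a function on the unit ball of `C`, is pre-stable. Only the values of `f` on the unit
ball are used. -/
def PreStable (f : C → D) : Prop :=
  ∀ (n : ℕ) (x : C), cnorm x ≤ 1 → ∀ u ∈ localBall n x, diffMinus f x u ≤ diffPlus f x u

/-- The `n`-th difference of `f` at `x` in the directions `u`. -/
noncomputable def diff {n : ℕ} (f : C → D) (x : C) (u : Fin n → C) : D :=
  coneSub (diffPlus f x u) (diffMinus f x u)

/-- The iterated sum of `g (y 1, …, y n)` over `y 1 ∈ π 1`, …, `y n ∈ π n`, with multiplicities. -/
def multiSum : {n : ℕ} → (Fin n → Multiset C) → ((Fin n → C) → D) → D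
  | 0, _, g => g Fin.elim0
  | _ + 1, π, g => ((π 0).map fun y => multiSum (Fin.tail π) fun v => g (Fin.cons y v)).sum

/-- The sum of the `n`-th differences of `f` at `x` along a tuple of partitions. -/
noncomputable def Phi {n : ℕ} (f : C → D) (x : C) (π : Fin n → Multiset C) : D :=
  multiSum π fun y => diff f x y

/-- The derivative of `f` at `x` of rank `n` in the directions `u`, for `u ∈ localBall n x`: the
infimum of `Phi f x π` over all tuples `π` of partitions of `u`. -/
noncomputable def ballDeriv {n : ℕ} (f : C → D) (x : C) (u : Fin n → C) : D :=
  coneInf (Phi f x '' parts u)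

open Classical in
/-- The `n`-homogeneous extension of the derivative to all tuples `u`: rescale `u` into the
unit ball of the local cone by some `r > 0`, and divide the derivative there by `r ^ n`. -/
noncomputable def higherDeriv {n : ℕ} (f : C → D) (x : C) (u : Fin n → C) : D :=
  if h : ∃ r : ℝ≥0, 0 < r ∧ r • u ∈ localBall n x then
    (h.choose ^ n)⁻¹ • ballDeriv f x (h.choose • u)
  else 0

/-- The Taylor partial sum of `f` at `x` of rank `N`. -/
noncomputable def taylorSum (f : C → D) (N : ℕ) (x y : C) : D :=
  f x + ∑ k ∈ Finset.Icc 1 N, ((k ! : ℝ≥0)⁻¹) • higherDeriv f x (fun _ : Fin k => y)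

/-- The Taylor series of `f` at `x`: the supremum of the Taylor partial sums. -/
noncomputable def taylorSeries (f : C → D) (x y : C) : D :=
  coneSup (Set.range fun N => taylorSum f N x y)

end Functions

end NormedCone

/-!
The order of a cone makes it a canonically ordered cancellative module over `ℝ≥0`, and directed
completeness gives it limits of decreasing sequences (`DecreasesTo`) that commute with finite sums.
In particular a directed-complete cone is Archimedean
(`IsDirectedComplete.le_of_forall_le_add_smul`), which allows estimates up to an arbitrarily small
multiple of a fixed element.

**Derivatives.** For a pre-stable function the defect of additivity of the `n`-th difference in one
direction is an `(n + 1)`-st difference (`PreStable.diff_update_add`), hence nonnegative. So halving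
the step decreases the difference quotients `2 ^ (j * n) • Δⁿ f (0 | 2⁻¹ ^ j • u)`, and they have a
limit, `dirDeriv f u`. The defect of additivity of the quotients is `2⁻¹ ^ j` times a bounded
quotient of order `n + 1`, so the limit is multilinear in `u` (`PreStable.multilinearDeriv`). Being
multilinear and below the difference, it is below the sum of the differences along any tuple of
partitions; and it is the infimum along partitions into equal parts. It is therefore the infimum
that defines the derivative (`PreStable.isGLB_dirDeriv`), and it is homogeneous of degree `n`. This
comparison replaces common refinements of partitions, hence the Riesz decomposition property.

**Taylor series.** Newton's formula (`PreStable.apply_nsmul_eq_sum`) writes `f x` as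
`∑ k, m.choose k • Δᵏ f (0 | x / m, …, x / m)`. As `m.choose k / m ^ k` tends to `1 / k!` from below
and the difference quotients decrease to the derivatives, the Taylor sums are at most `f x`
(`PreStable.taylorSum_le`). Comparison with the same formula at a slightly larger multiple of `x`
that is still in the unit ball bounds the remainder by a geometric sequence
(`PreStable.apply_le_taylorSum_add`).
-/

namespace NormedCone

open Filter Topology

/-! ### The order of a cone -/

section Order

variable {D : Type*} [AddCommMonoid D] [Module ℝ≥0 D] [NormedCone D]

instance instIsOrderedCancelAddMonoid : IsOrderedCancelAddMonoid D where
  add_le_add_left := by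
    rintro a b ⟨z, rfl⟩ c
    exact ⟨z, add_right_comm a z c⟩
  le_of_add_le_add_left := by
    rintro a b c ⟨z, hz⟩
    exact ⟨z, add_left_cancel' a _ _ (by rw [hz, add_assoc])⟩

instance instCanonicallyOrderedAdd : CanonicallyOrderedAdd D where
  exists_add_of_le h := h
  le_add_self a b := ⟨b, add_comm b a⟩
  le_self_add _ b := ⟨b, rfl⟩

instance instIsOrderedModule : IsOrderedModule ℝ≥0 D where
  smul_le_smul_of_nonneg_left := by
    rintro r - a b ⟨z, rfl⟩
    exact ⟨r • z, smul_add r a z⟩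
  smul_le_smul_of_nonneg_right := by
    rintro a - r s hrs
    obtain ⟨t, rfl⟩ := exists_add_of_le hrs
    exact ⟨t • a, add_smul r t a⟩

theorem cnorm_mono {x y : D} (h : x ≤ y) : cnorm x ≤ cnorm y := by
  obtain ⟨z, rfl⟩ := h
  exact cnorm_le_add x z

theorem smul_le_iff_le_inv_smul {r : ℝ≥0} (hr : 0 < r) {x y : D} : r • x ≤ y ↔ x ≤ r⁻¹ • y := by
  constructor <;> intro h
  · simpa [smul_smul, inv_mul_cancel₀ hr.ne'] using
      smul_le_smul_of_nonneg_left h (zero_le (a := r⁻¹))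
  · simpa [smul_smul, mul_inv_cancel₀ hr.ne'] using smul_le_smul_of_nonneg_left h (zero_le (a := r))

theorem add_coneSub_of_le {a b : D} (h : b ≤ a) : b + coneSub a b = a :=
  (Classical.epsilon_spec (p := fun z => a = b + z) h).symm

theorem coneInf_eq {S : Set D} {d : D} (h : IsGLB S d) : coneInf S = d :=
  (Classical.epsilon_spec (p := fun d => IsGLB S d) ⟨d, h⟩).unique h

theorem coneSup_eq {S : Set D} {d : D} (h : IsLUB S d) : coneSup S = d :=
  (Classical.epsilon_spec (p := fun d => IsLUB S d) ⟨d, h⟩).unique h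

/-- By homogeneity, the radius of the ball in the definition of directed completeness is
irrelevant. -/
theorem IsDirectedComplete.exists_isLUB (hD : IsDirectedComplete D) {S : Set D} (hS : S.Nonempty)
    (hdir : DirectedOn (· ≤ ·) S) {b : D} (hb : b ∈ upperBounds S) : ∃ s, IsLUB S s := by
  set c : ℝ≥0 := (cnorm b + 1)⁻¹ with hc
  have hc0 : 0 < c := by positivity
  obtain ⟨s, -, hs⟩ := hD ((fun x => c • x) '' S) (hS.image _)
    (by
      rintro _ ⟨x, hx, rfl⟩ _ ⟨y, hy, rfl⟩
      obtain ⟨z, hz, hxz, hyz⟩ := hdir x hx y hy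
      exact ⟨c • z, ⟨z, hz, rfl⟩, smul_le_smul_of_nonneg_left hxz zero_le,
        smul_le_smul_of_nonneg_left hyz zero_le⟩)
    (by
      rintro _ ⟨x, hx, rfl⟩
      have h1 : cnorm x ≤ cnorm b + 1 := (cnorm_mono (hb hx)).trans (by simp)
      calc cnorm (c • x) = c * cnorm x := cnorm_smul c x
        _ ≤ c * (cnorm b + 1) := by gcongr
        _ = 1 := by rw [hc]; exact inv_mul_cancel₀ (by positivity))
  refine ⟨c⁻¹ • s, fun x hx => ?_, fun d hd => ?_⟩
  · exact (smul_le_iff_le_inv_smul hc0).1 (hs.1 ⟨x, hx, rfl⟩)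
  · rw [smul_le_iff_le_inv_smul (inv_pos.2 hc0), inv_inv]
    refine hs.2 ?_
    rintro _ ⟨x, hx, rfl⟩
    exact smul_le_smul_of_nonneg_left (hd hx) zero_le

end Order

/-! ### Limits of decreasing sequences -/

section Limit

theorem tendsto_inv_two_pow : Tendsto (fun j : ℕ => ((2 : ℝ≥0) ^ j)⁻¹) atTop (𝓝 0) := by
  simp_rw [← inv_pow]
  exact tendsto_pow_atTop_nhds_zero_of_lt_one zero_le (inv_lt_one_of_one_lt₀ one_lt_two)

variable {D : Type*} [AddCommMonoid D] [Module ℝ≥0 D] [NormedCone D]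

/-- The sequence `q` is eventually decreasing, and `l` is the infimum of its decreasing tails. The
infimum is encoded through its lower bounds, which makes `l` unique. -/
structure DecreasesTo (q : ℕ → D) (l : D) : Prop where
  eventually_antitone : ∃ N, ∀ i j, N ≤ i → i ≤ j → q j ≤ q i
  le_iff : ∀ d, d ≤ l ↔ ∀ᶠ j in atTop, d ≤ q j

namespace DecreasesTo

variable {q q' : ℕ → D} {l l' : D}

theorem eventually_le (h : DecreasesTo q l) : ∀ᶠ j in atTop, l ≤ q j :=
  (h.le_iff l).1 le_rfl

theorem unique (h : DecreasesTo q l) (h' : DecreasesTo q l') : l = l' :=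
  le_antisymm ((h'.le_iff l).2 h.eventually_le) ((h.le_iff l').2 h'.eventually_le)

theorem congr (h : DecreasesTo q l) (hq : ∀ᶠ j in atTop, q' j = q j) : DecreasesTo q' l := by
  obtain ⟨N, hN⟩ := h.eventually_antitone
  obtain ⟨N', hN'⟩ := eventually_atTop.1 hq
  refine ⟨⟨max N N', fun i j hi hij => ?_⟩, fun d => (h.le_iff d).trans (eventually_congr ?_)⟩
  · rw [hN' i (by omega), hN' j (by omega)]
    exact hN i j (by omega) hij
  · filter_upwards [hq] with j hj
    rw [hj]

theorem le_of_antitone (h : DecreasesTo q l) {N : ℕ} (hN : ∀ i j, N ≤ i → i ≤ j → q j ≤ q i)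
    {i : ℕ} (hi : N ≤ i) : l ≤ q i := by
  obtain ⟨j, hj, hij⟩ := (h.eventually_le.and (eventually_ge_atTop i)).exists
  exact hj.trans (hN i j hi hij)

theorem const (a : D) : DecreasesTo (fun _ => a) a :=
  ⟨⟨0, fun _ _ _ _ => le_rfl⟩, fun _ => (eventually_const (f := atTop)).symm⟩

theorem smul (h : DecreasesTo q l) (r : ℝ≥0) : DecreasesTo (fun j => r • q j) (r • l) := by
  rcases eq_or_ne r 0 with rfl | hr
  · simpa using const (0 : D)
  have hr : 0 < r⁻¹ := inv_pos.2 (pos_iff_ne_zero.2 hr)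
  obtain ⟨N, hN⟩ := h.eventually_antitone
  refine ⟨⟨N, fun i j hi hij => smul_le_smul_of_nonneg_left (hN i j hi hij) zero_le⟩,
    fun d => ?_⟩
  have key (z : D) : d ≤ r • z ↔ r⁻¹ • d ≤ z := by rw [smul_le_iff_le_inv_smul hr, inv_inv]
  simp only [key]
  exact h.le_iff _

end DecreasesTo

namespace IsDirectedComplete

variable (hD : IsDirectedComplete D)

include hD

/-- If `q` decreases from `q N` on, then `q N - q j` increases in `j` and has a least upper bound
`s` below `q N`; the limit of `q` is `q N - s`. -/
theorem exists_decreasesTo {q : ℕ → D} {N : ℕ} (hN : ∀ i j, N ≤ i → i ≤ j → q j ≤ q i) :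
    ∃ l, DecreasesTo q l := by
  obtain ⟨s, hs⟩ := hD.exists_isLUB (S := {z | ∃ j, N ≤ j ∧ q N = q j + z}) (b := q N)
    ⟨0, N, le_rfl, (add_zero _).symm⟩
    (by
      have hmono {i j : ℕ} (hi : N ≤ i) (hij : i ≤ j) {x y : D} (hx : q N = q i + x)
          (hy : q N = q j + y) : x ≤ y := by
        refine le_of_add_le_add_left (a := q j) ?_
        rw [← hy, hx]
        exact add_le_add_left (hN i j hi hij) x
      rintro x ⟨i, hi, hx⟩ y ⟨j, hj, hy⟩
      rcases le_total i j with hij | hij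
      · exact ⟨y, ⟨j, hj, hy⟩, hmono hi hij hx hy, le_rfl⟩
      · exact ⟨x, ⟨i, hi, hx⟩, le_rfl, hmono hj hij hy hx⟩)
    (by
      rintro z ⟨j, -, hz⟩
      exact ⟨q j, by rw [hz, add_comm]⟩)
  obtain ⟨l, hl⟩ : s ≤ q N := hs.2 (by
    rintro z ⟨j, -, hz⟩
    exact ⟨q j, by rw [hz, add_comm]⟩)
  have hle (j : ℕ) (hj : N ≤ j) : l ≤ q j := by
    obtain ⟨z, hz⟩ := hN N j le_rfl hj
    have hzs : z ≤ s := hs.1 ⟨j, hj, hz⟩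
    refine le_of_add_le_add_left (a := s) ?_
    rw [← hl, hz, add_comm]
    exact add_le_add_left hzs (q j)
  refine ⟨l, ⟨N, hN⟩, fun d => ⟨fun hd => ?_, fun hd => ?_⟩⟩
  · filter_upwards [eventually_ge_atTop N] with j hj using hd.trans (hle j hj)
  · have hdj (j : ℕ) (hj : N ≤ j) : d ≤ q j := by
      obtain ⟨i, hi, hij⟩ := (hd.and (eventually_ge_atTop j)).exists
      exact hi.trans (hN j i hj hij)
    obtain ⟨z, hz⟩ := hdj N le_rfl
    have hsz : s ≤ z := hs.2 (by
      rintro y ⟨j, hj, hy⟩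
      refine le_of_add_le_add_left (a := d) ?_
      rw [← hz, hy]
      exact add_le_add_left (hdj j hj) y)
    refine le_of_add_le_add_left (a := s) ?_
    rw [← hl, hz, add_comm]
    exact add_le_add_right hsz d

theorem decreasesTo_const_add {q : ℕ → D} {l : D} (c : D) (h : DecreasesTo q l) :
    DecreasesTo (fun j => c + q j) (c + l) := by
  obtain ⟨N, hN⟩ := h.eventually_antitone
  have hN' : ∀ i j, N ≤ i → i ≤ j → c + q j ≤ c + q i := fun i j hi hij =>
    add_le_add_right (hN i j hi hij) c
  obtain ⟨g, hg⟩ := hD.exists_decreasesTo hN'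
  obtain ⟨t, rfl⟩ : c ≤ g := (hg.le_iff c).2 (.of_forall fun j => le_self_add)
  have hlt : l = t := h.unique ⟨⟨N, hN⟩, fun d => by
    rw [← add_le_add_iff_left c, hg.le_iff]
    simp only [add_le_add_iff_left]⟩
  rwa [hlt]

theorem decreasesTo_add {q q' : ℕ → D} {l l' : D} (h : DecreasesTo q l) (h' : DecreasesTo q' l') :
    DecreasesTo (fun j => q j + q' j) (l + l') := by
  obtain ⟨N, hN⟩ := h.eventually_antitone
  obtain ⟨N', hN'⟩ := h'.eventually_antitone
  have hanti : ∀ i j, max N N' ≤ i → i ≤ j → q j + q' j ≤ q i + q' i := fun i j hi hij =>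
    add_le_add (hN i j (by omega) hij) (hN' i j (by omega) hij)
  refine ⟨⟨_, hanti⟩, fun d => ⟨fun hd => ?_, fun hd => ?_⟩⟩
  · filter_upwards [h.eventually_le, h'.eventually_le] with j hj hj'
    exact hd.trans (add_le_add hj hj')
  -- The two indices are decoupled: first `q'` decreases with `q i` fixed, then `q i` decreases.
  · have hi : ∀ᶠ i in atTop, d ≤ l' + q i := by
      filter_upwards [eventually_ge_atTop N] with i hi
      rw [add_comm, (hD.decreasesTo_const_add (q i) h').le_iff]
      filter_upwards [hd, eventually_ge_atTop i] with j hj hij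
      exact hj.trans (add_le_add_left (hN i j hi hij) _)
    rw [add_comm, (hD.decreasesTo_const_add l' h).le_iff]
    exact hi

theorem decreasesTo_sum {ι : Type*} (s : Finset ι) {q : ι → ℕ → D} {l : ι → D}
    (h : ∀ i ∈ s, DecreasesTo (q i) (l i)) :
    DecreasesTo (fun j => ∑ i ∈ s, q i j) (∑ i ∈ s, l i) := by
  classical
  induction s using Finset.induction_on with
  | empty => simpa using DecreasesTo.const (0 : D)
  | insert a s ha ih =>
    simp only [Finset.sum_insert ha]
    exact hD.decreasesTo_add (h a (by simp)) (ih fun i hi => h i (by simp [hi]))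

theorem decreasesTo_inv_two_pow_smul (R : D) :
    DecreasesTo (fun j => ((2 : ℝ≥0) ^ j)⁻¹ • R) 0 := by
  have hanti : ∀ i j, 0 ≤ i → i ≤ j → ((2 : ℝ≥0) ^ j)⁻¹ • R ≤ ((2 : ℝ≥0) ^ i)⁻¹ • R := by
    intro i j _ hij
    gcongr
    norm_num
  obtain ⟨l, hl⟩ := hD.exists_decreasesTo hanti
  have hl0 : cnorm l = 0 := by
    have hlim := tendsto_inv_two_pow.mul_const (cnorm R)
    refine le_antisymm ?_ zero_le
    rw [← zero_mul (cnorm R)]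
    refine ge_of_tendsto hlim ?_
    filter_upwards [hl.eventually_le] with j hj
    rw [← cnorm_smul]
    exact cnorm_mono hj
  rwa [eq_zero_of_cnorm l hl0] at hl

/-- A directed-complete cone is Archimedean. -/
theorem le_of_forall_le_add_smul {d b R : D} (h : ∀ ε : ℝ≥0, 0 < ε → d ≤ b + ε • R) : d ≤ b := by
  rw [← add_zero b, (hD.decreasesTo_const_add b (hD.decreasesTo_inv_two_pow_smul R)).le_iff]
  exact .of_forall fun j => h _ (by positivity)

/-- Additive maps out of `ℝ≥0` are monotone, hence homogeneous by the Archimedean property. -/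
theorem addMonoidHom_apply_eq_smul (g : ℝ≥0 →+ D) (t : ℝ≥0) : g t = t • g 1 := by
  have hnat (k : ℕ) : g k = (k : ℝ≥0) • g 1 := by
    rw [← nsmul_one k, map_nsmul, nsmul_one, Nat.cast_smul_eq_nsmul]
  have hmono {s t : ℝ≥0} (hst : s ≤ t) : g s ≤ g t := by
    obtain ⟨r, rfl⟩ := exists_add_of_le hst
    exact ⟨g r, map_add g s r⟩
  have hlow (t : ℝ≥0) : t • g 1 ≤ g t := by
    refine hD.le_of_forall_le_add_smul (R := g 1) fun ε hε => ?_
    obtain ⟨m, hm⟩ := exists_nat_gt ε⁻¹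
    have hm0 : (0 : ℝ≥0) < m := (inv_pos.2 hε).trans hm
    have h1 : ((m : ℝ≥0) * t) • g 1 ≤ (m : ℝ≥0) • g t + g 1 :=
      calc ((m : ℝ≥0) * t) • g 1 ≤ ((⌊(m : ℝ≥0) * t⌋₊ : ℝ≥0) + 1) • g 1 := by
            gcongr
            exact (Nat.lt_floor_add_one _).le
        _ = g (⌊(m : ℝ≥0) * t⌋₊ : ℝ≥0) + g 1 := by rw [add_smul, one_smul, hnat]
        _ ≤ g (m * t) + g 1 := by
            gcongr
            exact hmono (Nat.floor_le zero_le)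
        _ = (m : ℝ≥0) • g t + g 1 := by
            rw [← nsmul_eq_mul, map_nsmul, Nat.cast_smul_eq_nsmul]
    rw [mul_smul, smul_le_iff_le_inv_smul hm0, smul_add, smul_smul, inv_mul_cancel₀ hm0.ne',
      one_smul] at h1
    refine h1.trans ?_
    gcongr
    exact (inv_lt_of_inv_lt₀ hε hm).le
  refine le_antisymm ?_ (hlow t)
  obtain ⟨k, hk⟩ := exists_nat_ge t
  obtain ⟨r, hr⟩ := exists_add_of_le hk
  refine le_of_add_le_add_right (a := r • g 1) ?_
  rw [← add_smul, ← hr, ← hnat, hr, map_add]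
  exact add_le_add_right (hlow r) _

end IsDirectedComplete

end Limit

/-! ### Finite differences of pre-stable functions -/

section DiffFormulas

variable {C D : Type*} [AddCommMonoid C] [AddCommMonoid D]

/-- A subset of `Fin (n + 1)` is a subset of `Fin n` shifted by one, with or without `0`. -/
theorem sum_finset_fin_succ {M : Type*} [AddCommMonoid M] {n : ℕ} (h : Finset (Fin (n + 1)) → M) :
    ∑ I, h I = ∑ I : Finset (Fin n), h (I.map (Fin.succEmb n)) +
      ∑ I : Finset (Fin n), h (insert 0 (I.map (Fin.succEmb n))) := by
  have h0 : (0 : Fin (n + 1)) ∉ (Finset.univ : Finset (Fin n)).image Fin.succ := by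
    simp
  have huniv : (Finset.univ : Finset (Finset (Fin (n + 1)))) =
      (insert 0 ((Finset.univ : Finset (Fin n)).image Fin.succ)).powerset := by
    rw [← Finset.powerset_univ]
    congr 1
    ext i
    cases i using Fin.cases <;> simp
  have hinj : Function.Injective (Finset.image (Fin.succ (n := n))) :=
    Finset.image_injective (Fin.succ_injective n)
  rw [huniv, Finset.sum_powerset_insert h0, Finset.powerset_image, Finset.powerset_univ,
    Finset.sum_image hinj.injOn, Finset.sum_image hinj.injOn]
  simp only [Finset.map_eq_image, Fin.coe_succEmb]

theorem diffPlus_cons {n : ℕ} (f : C → D) (x a : C) (u : Fin n → C) :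
    diffPlus f x (Fin.cons a u : Fin (n + 1) → C) = diffMinus f x u + diffPlus f (x + a) u := by
  simp only [diffPlus, diffMinus, Finset.sum_filter]
  rw [sum_finset_fin_succ]
  congr 1 <;> refine Finset.sum_congr rfl fun I _ => ?_
  · have hI : I.card ≤ n := by simpa using Finset.card_le_univ I
    simp only [Finset.card_map, Finset.sum_map, Fin.coe_succEmb, Fin.cons_succ]
    simp only [Nat.succ_sub hI, Nat.succ_eq_add_one, Nat.even_add_one, Nat.not_even_iff_odd]
  · rw [Finset.card_insert_of_notMem (by simp [Fin.succ_ne_zero]),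
      Finset.sum_insert (by simp [Fin.succ_ne_zero])]
    simp only [Finset.card_map, Finset.sum_map, Fin.coe_succEmb, Fin.cons_succ, Fin.cons_zero,
      Nat.add_sub_add_right, add_assoc]

theorem diffMinus_cons {n : ℕ} (f : C → D) (x a : C) (u : Fin n → C) :
    diffMinus f x (Fin.cons a u : Fin (n + 1) → C) = diffPlus f x u + diffMinus f (x + a) u := by
  simp only [diffPlus, diffMinus, Finset.sum_filter]
  rw [sum_finset_fin_succ]
  congr 1 <;> refine Finset.sum_congr rfl fun I _ => ?_
  · have hI : I.card ≤ n := by simpa using Finset.card_le_univ I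
    simp only [Finset.card_map, Finset.sum_map, Fin.coe_succEmb, Fin.cons_succ]
    simp only [Nat.succ_sub hI, Nat.succ_eq_add_one, Nat.odd_add_one, Nat.not_odd_iff_even]
  · rw [Finset.card_insert_of_notMem (by simp [Fin.succ_ne_zero]),
      Finset.sum_insert (by simp [Fin.succ_ne_zero])]
    simp only [Finset.card_map, Finset.sum_map, Fin.coe_succEmb, Fin.cons_succ, Fin.cons_zero,
      Nat.add_sub_add_right, add_assoc]

theorem diff_fin_zero [Module ℝ≥0 D] [NormedCone D] (f : C → D) (x : C) (u : Fin 0 → C) :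
    diff f x u = f x := by
  have hp : diffPlus f x u = f x := by
    simp [diffPlus, show (default : Finset (Fin 0)) = ∅ from rfl]
  have hm : diffMinus f x u = 0 := by simp [diffMinus]
  have h := add_coneSub_of_le (zero_le (a := f x))
  rwa [diff, hp, hm, ← zero_add (coneSub _ _)]

theorem diff_comp_perm {n : ℕ} (f : C → D) (x : C) (u : Fin n → C) (σ : Equiv.Perm (Fin n)) :
    diff f x (u ∘ σ) = diff f x u := by
  have hp : diffPlus f x (u ∘ σ) = diffPlus f x u := by
    simp only [diffPlus, Finset.sum_filter]
    exact Fintype.sum_equiv σ.finsetCongr _ _ fun I => by simp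
  have hm : diffMinus f x (u ∘ σ) = diffMinus f x u := by
    simp only [diffMinus, Finset.sum_filter]
    exact Fintype.sum_equiv σ.finsetCongr _ _ fun I => by simp
  rw [diff, hp, hm, diff]

end DiffFormulas

section Diff

variable {C D : Type*} [AddCommMonoid C] [Module ℝ≥0 C] [NormedCone C]
  [AddCommMonoid D] [Module ℝ≥0 D] [NormedCone D]

theorem localBall_of_le {m n : ℕ} {x y : C} {u : Fin m → C} {v : Fin n → C}
    (hv : v ∈ localBall n y) (h : x + ∑ i, u i ≤ y + ∑ i, v i) : u ∈ localBall m x :=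
  (cnorm_mono h).trans hv

variable {f : C → D}

namespace PreStable

variable (hf : PreStable f)

include hf

theorem diffMinus_add_diff {n : ℕ} {x : C} {u : Fin n → C} (hu : u ∈ localBall n x) :
    diffMinus f x u + diff f x u = diffPlus f x u :=
  add_coneSub_of_le (hf n x ((cnorm_le_add _ _).trans hu) u hu)

theorem diff_add_diff_cons {n : ℕ} {x a : C} {u : Fin n → C}
    (hu : (Fin.cons a u : Fin (n + 1) → C) ∈ localBall (n + 1) x) :
    diff f x u + diff f x (Fin.cons a u : Fin (n + 1) → C) = diff f (x + a) u := by
  have hxa : x + ∑ i, (Fin.cons a u : Fin (n + 1) → C) i = x + a + ∑ i, u i := by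
    simp [Fin.sum_univ_succ, add_assoc]
  have h1 : u ∈ localBall n (x + a) := localBall_of_le hu hxa.ge
  have h2 : u ∈ localBall n x := localBall_of_le h1 (add_le_add_left le_self_add _)
  have e0 := hf.diffMinus_add_diff hu
  have e1 := hf.diffMinus_add_diff h1
  have e2 := hf.diffMinus_add_diff h2
  rw [diffPlus_cons, diffMinus_cons, ← e1, ← e2] at e0
  refine add_left_cancel (a := diffMinus f x u + diffMinus f (x + a) u) ?_
  calc _ = diffMinus f x u + diff f x u + diffMinus f (x + a) u +
        diff f x (Fin.cons a u : Fin (n + 1) → C) := by abel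
    _ = _ := by rw [e0]; abel

/-- The defect of additivity in a direction is the difference of the next order. -/
theorem diff_cons_add {n : ℕ} {x a b : C} {v : Fin n → C}
    (hv : (Fin.cons (a + b) v : Fin (n + 1) → C) ∈ localBall (n + 1) x) :
    diff f x (Fin.cons (a + b) v : Fin (n + 1) → C) =
      diff f x (Fin.cons a v : Fin (n + 1) → C) + diff f x (Fin.cons b v : Fin (n + 1) → C) +
        diff f x (Fin.cons b (Fin.cons a v : Fin (n + 1) → C) : Fin (n + 2) → C) := by
  have hsum : x + ∑ i, (Fin.cons (a + b) v : Fin (n + 1) → C) i = x + (a + (b + ∑ i, v i)) := by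
    simp [Fin.sum_univ_succ, add_assoc]
  have ha : (Fin.cons a v : Fin (n + 1) → C) ∈ localBall (n + 1) x := localBall_of_le hv (by
    rw [hsum]
    simp only [Fin.sum_univ_succ, Fin.cons_zero, Fin.cons_succ]
    gcongr
    exact le_add_self)
  have hb : (Fin.cons b v : Fin (n + 1) → C) ∈ localBall (n + 1) x := localBall_of_le hv (by
    rw [hsum]
    simp only [Fin.sum_univ_succ, Fin.cons_zero, Fin.cons_succ]
    exact add_le_add_right le_add_self x)
  have hab : (Fin.cons a v : Fin (n + 1) → C) ∈ localBall (n + 1) (x + b) :=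
    localBall_of_le hv (by
      rw [hsum]
      simp only [Fin.sum_univ_succ, Fin.cons_zero, Fin.cons_succ]
      exact le_of_eq (by abel))
  have hba : (Fin.cons b (Fin.cons a v : Fin (n + 1) → C) : Fin (n + 2) → C) ∈
      localBall (n + 2) x := localBall_of_le hv (by
    rw [hsum]
    simp only [Fin.sum_univ_succ, Fin.cons_zero, Fin.cons_succ]
    exact le_of_eq (by abel))
  have e := hf.diff_add_diff_cons hv
  have e1 := hf.diff_add_diff_cons hab
  rw [← hf.diff_add_diff_cons hb, ← hf.diff_add_diff_cons hba, add_assoc, add_assoc x b a,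
    add_comm b a, ← e] at e1
  refine add_left_cancel (a := diff f x v) ?_
  rw [← e1]
  abel

theorem diff_update_add {n : ℕ} {x : C} {u : Fin n → C} {i : Fin n} {a b : C}
    (hu : Function.update u i (a + b) ∈ localBall n x) :
    diff f x (Function.update u i (a + b)) =
      diff f x (Function.update u i a) + diff f x (Function.update u i b) +
        diff f x (Fin.cons b (Function.update u i a) : Fin (n + 1) → C) := by
  obtain _ | n := n
  · exact i.elim0
  -- A permutation of the directions reduces the claim to the direction of index `0`.
  set σ : Equiv.Perm (Fin (n + 1)) := Equiv.swap 0 i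
  have hupd (c : C) : Function.update u i c ∘ σ = Fin.cons c (Fin.tail (u ∘ σ)) := by
    rw [Function.update_comp_equiv, Equiv.symm_swap, Equiv.swap_apply_right]
    conv_lhs => rw [← Fin.cons_self_tail (u ∘ σ)]
    rw [Fin.update_cons_zero]
  have hball : (Function.update u i (a + b) ∘ σ) ∈ localBall (n + 1) x :=
    localBall_of_le hu (by
      rw [← Equiv.sum_comp σ (Function.update u i (a + b))]
      rfl)
  have hcons : diff f x (Fin.cons b (Function.update u i a) : Fin (n + 2) → C) =
      diff f x (Fin.cons b (Function.update u i a ∘ σ : Fin (n + 1) → C) : Fin (n + 2) → C) := by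
    have hsum : x + ∑ j, (Fin.cons b (Function.update u i a) : Fin (n + 2) → C) j =
        x + ∑ j, Function.update u i (a + b) j := by
      simp only [Fin.sum_univ_succ (n := n + 1), Fin.cons_zero, Fin.cons_succ,
        Finset.sum_update_of_mem (Finset.mem_univ i)]
      abel
    have h1 := localBall_of_le hu hsum.le
    have h2 : (Fin.cons b (Function.update u i a ∘ σ : Fin (n + 1) → C) : Fin (n + 2) → C) ∈
        localBall (n + 2) x := localBall_of_le h1 (by
      simp only [Fin.sum_univ_succ (n := n + 1), Fin.cons_zero, Fin.cons_succ]
      rw [← Equiv.sum_comp σ (Function.update u i a)]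
      rfl)
    have e1 := hf.diff_add_diff_cons h1
    have e2 := hf.diff_add_diff_cons h2
    rw [diff_comp_perm, diff_comp_perm, ← e1] at e2
    exact (add_left_cancel e2).symm
  rw [hcons, ← diff_comp_perm f x (Function.update u i (a + b)) σ,
    ← diff_comp_perm f x (Function.update u i a) σ, ← diff_comp_perm f x (Function.update u i b) σ]
  simp only [hupd] at hball ⊢
  exact hf.diff_cons_add hball

theorem two_pow_smul_diff_half_le {n : ℕ} {x : C} {u : Fin n → C} (hu : u ∈ localBall n x) :
    (2 : ℝ≥0) ^ n • diff f x ((2 : ℝ≥0)⁻¹ • u) ≤ diff f x u := by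
  have hhalf (a : C) : (2 : ℝ≥0)⁻¹ • a + (2 : ℝ≥0)⁻¹ • a = a := by
    rw [← add_smul, ← two_mul, mul_inv_cancel₀ two_ne_zero, one_smul]
  -- The directions are halved one at a time.
  have key (s : Finset (Fin n)) :
      s.piecewise ((2 : ℝ≥0)⁻¹ • u) u ∈ localBall n x ∧
      (2 : ℝ≥0) ^ s.card • diff f x (s.piecewise ((2 : ℝ≥0)⁻¹ • u) u) ≤ diff f x u := by
    have hmem (s : Finset (Fin n)) : s.piecewise ((2 : ℝ≥0)⁻¹ • u) u ∈ localBall n x := by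
      refine localBall_of_le hu (add_le_add_right (Finset.sum_le_sum fun i _ => ?_) x)
      by_cases hi : i ∈ s
      · rw [Finset.piecewise_eq_of_mem _ _ _ hi]
        exact ⟨(2 : ℝ≥0)⁻¹ • u i, (hhalf (u i)).symm⟩
      · rw [Finset.piecewise_eq_of_notMem _ _ _ hi]
    refine ⟨hmem s, ?_⟩
    induction s using Finset.induction_on with
    | empty => simp
    | insert i s hi ih =>
      refine le_trans ?_ ih
      rw [Finset.card_insert_of_notMem hi, pow_succ, mul_smul, Finset.piecewise_insert]
      refine smul_le_smul_of_nonneg_left ?_ zero_le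
      set v := s.piecewise ((2 : ℝ≥0)⁻¹ • u) u with hv
      have hvi : Function.update v i ((2 : ℝ≥0)⁻¹ • u i + (2 : ℝ≥0)⁻¹ • u i) = v := by
        rw [hhalf, Function.update_eq_self_iff, hv, Finset.piecewise_eq_of_notMem _ _ _ hi]
      have h := hf.diff_update_add (x := x) (by rw [hvi]; exact hmem s)
      rw [hvi] at h
      rw [h, two_smul]
      exact le_self_add
  simpa using (key Finset.univ).2

end PreStable

end Diff

/-! ### Directional derivatives along dyadic scales -/

section DirDeriv

theorem inv_two_pow_succ_smul {M : Type*} [AddCommMonoid M] [Module ℝ≥0 M] (j : ℕ) (u : M) :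
    ((2 : ℝ≥0) ^ (j + 1))⁻¹ • u = (2 : ℝ≥0)⁻¹ • ((2 : ℝ≥0) ^ j)⁻¹ • u := by
  rw [smul_smul, pow_succ, mul_inv_rev]

theorem smul_fin_cons {M : Type*} [AddCommMonoid M] [Module ℝ≥0 M] {n : ℕ} (r : ℝ≥0) (a : M)
    (u : Fin n → M) :
    r • (Fin.cons a u : Fin (n + 1) → M) = Fin.cons (r • a) (r • u) := by
  funext i
  cases i using Fin.cases <;> simp

variable {C D : Type*} [AddCommMonoid C] [Module ℝ≥0 C] [NormedCone C]
  [AddCommMonoid D] [Module ℝ≥0 D] [NormedCone D]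

/-- The difference quotient of `f` at `0` in the directions `u`, with step `2⁻¹ ^ j`. -/
noncomputable def dyadicQuotient {n : ℕ} (f : C → D) (u : Fin n → C) (j : ℕ) : D :=
  ((2 : ℝ≥0) ^ j) ^ n • diff f 0 (((2 : ℝ≥0) ^ j)⁻¹ • u)

/-- The directional derivative of `f` at `0`: the limit of the dyadic difference quotients. These
only make sense from some rank on, so that `u` need not be small. -/
noncomputable def dirDeriv {n : ℕ} (f : C → D) (u : Fin n → C) : D :=
  Classical.epsilon fun l => DecreasesTo (dyadicQuotient f u) l

theorem eventually_smul_mem_localBall {n : ℕ} (u : Fin n → C) :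
    ∀ᶠ j : ℕ in atTop, ((2 : ℝ≥0) ^ j)⁻¹ • u ∈ localBall n 0 := by
  have hlim := tendsto_inv_two_pow.mul_const (cnorm (∑ i, u i))
  rw [zero_mul] at hlim
  filter_upwards [hlim.eventually_le_const zero_lt_one] with j hj
  rw [← cnorm_smul, Finset.smul_sum] at hj
  simpa [localBall] using hj

theorem smul_mem_localBall {n : ℕ} {u : Fin n → C} (hu : u ∈ localBall n 0) {r : ℝ≥0}
    (hr : r ≤ 1) : r • u ∈ localBall n 0 :=
  localBall_of_le hu (add_le_add_right (Finset.sum_le_sum fun i _ => by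
    simpa using smul_le_smul_of_nonneg_right hr (zero_le (a := u i))) 0)

namespace PreStable

variable {f : C → D} (hf : PreStable f)

include hf

theorem dyadicQuotient_antitone {n : ℕ} {u : Fin n → C} {N : ℕ}
    (hN : ((2 : ℝ≥0) ^ N)⁻¹ • u ∈ localBall n 0) {i j : ℕ} (hi : N ≤ i) (hij : i ≤ j) :
    dyadicQuotient f u j ≤ dyadicQuotient f u i := by
  have hmem : ∀ i, N ≤ i → ((2 : ℝ≥0) ^ i)⁻¹ • u ∈ localBall n 0 := fun i hi => by
    induction i, hi using Nat.le_induction with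
    | base => exact hN
    | succ i hi ih =>
      rw [inv_two_pow_succ_smul]
      exact smul_mem_localBall ih (inv_le_one_of_one_le₀ one_le_two)
  induction j, hij using Nat.le_induction with
  | base => exact le_rfl
  | succ j hij ih =>
    refine le_trans ?_ ih
    rw [dyadicQuotient, dyadicQuotient, pow_succ, mul_pow, mul_smul, ← pow_succ,
      inv_two_pow_succ_smul]
    exact smul_le_smul_of_nonneg_left
      (hf.two_pow_smul_diff_half_le (hmem j (hi.trans hij))) zero_le

variable (hD : IsDirectedComplete D)

include hD

theorem decreasesTo_dirDeriv {n : ℕ} (u : Fin n → C) :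
    DecreasesTo (dyadicQuotient f u) (dirDeriv f u) := by
  obtain ⟨N, hN⟩ := (eventually_smul_mem_localBall u).exists
  obtain ⟨l, hl⟩ := hD.exists_decreasesTo fun i j hi hij => hf.dyadicQuotient_antitone hN hi hij
  exact Classical.epsilon_spec (p := fun l => DecreasesTo (dyadicQuotient f u) l) ⟨l, hl⟩

theorem dirDeriv_le_diff {n : ℕ} {u : Fin n → C} (hu : u ∈ localBall n 0) :
    dirDeriv f u ≤ diff f 0 u := by
  have h := (hf.decreasesTo_dirDeriv hD u).le_of_antitone (N := 0)
    (fun i j hi hij => hf.dyadicQuotient_antitone (by simpa using hu) hi hij) le_rfl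
  simpa [dyadicQuotient] using h

theorem dirDeriv_update_add {n : ℕ} (u : Fin n → C) (i : Fin n) (a b : C) :
    dirDeriv f (Function.update u i (a + b)) =
      dirDeriv f (Function.update u i a) + dirDeriv f (Function.update u i b) := by
  set w : Fin (n + 1) → C := Fin.cons b (Function.update u i a) with hw
  -- The defect of additivity at step `2⁻¹ ^ j` is a difference quotient of order `n + 1`, with
  -- one factor `2 ^ j` too few.
  have herr : DecreasesTo (fun j => ((2 : ℝ≥0) ^ j)⁻¹ • dyadicQuotient f w j) 0 := by
    have hq := hf.decreasesTo_dirDeriv hD w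
    obtain ⟨N, hN⟩ := hq.eventually_antitone
    have h0 := hD.decreasesTo_inv_two_pow_smul (dyadicQuotient f w N)
    refine ⟨⟨N, fun i j hi hij => ?_⟩, fun d => ⟨fun hd => ?_, fun hd => (h0.le_iff d).2 ?_⟩⟩
    · have h2 : ((2 : ℝ≥0) ^ j)⁻¹ ≤ ((2 : ℝ≥0) ^ i)⁻¹ := by
        gcongr
        exact one_le_two
      exact smul_le_smul h2 (hN i j hi hij) zero_le zero_le
    · exact .of_forall fun j => hd.trans zero_le
    · filter_upwards [hd, eventually_ge_atTop N] with j hj hNj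
      exact hj.trans (smul_le_smul_of_nonneg_left (hN N j le_rfl hNj) zero_le)
  have h := hD.decreasesTo_add (hD.decreasesTo_add
    (hf.decreasesTo_dirDeriv hD (Function.update u i a))
    (hf.decreasesTo_dirDeriv hD (Function.update u i b))) herr
  rw [add_zero] at h
  refine (hf.decreasesTo_dirDeriv hD _).unique (h.congr ?_)
  filter_upwards [eventually_smul_mem_localBall (Function.update u i (a + b))] with j hj
  have hupd (c : C) : ((2 : ℝ≥0) ^ j)⁻¹ • Function.update u i c =
      Function.update (((2 : ℝ≥0) ^ j)⁻¹ • u) i (((2 : ℝ≥0) ^ j)⁻¹ • c) :=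
    (Function.update_smul _ u i c).symm
  have h2 : ((2 : ℝ≥0) ^ j)⁻¹ * ((2 : ℝ≥0) ^ j) ^ (n + 1) = ((2 : ℝ≥0) ^ j) ^ n := by
    rw [pow_succ', ← mul_assoc, inv_mul_cancel₀ (by positivity), one_mul]
  rw [hupd, smul_add] at hj
  simp only [dyadicQuotient, hw, smul_smul, h2, smul_fin_cons, hupd, smul_add]
  rw [hf.diff_update_add hj, smul_add, smul_add]

/-- The directional derivatives of order `n` as a multilinear map. Additivity in each direction
gives homogeneity, as a directed-complete cone is Archimedean. -/
noncomputable def multilinearDeriv (n : ℕ) : MultilinearMap ℝ≥0 (fun _ : Fin n => C) D :=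
  MultilinearMap.mk' (dirDeriv f)
    (fun u i a b => hf.dirDeriv_update_add hD u i a b)
    (fun u i r a => by
      have hzero : dirDeriv f (Function.update u i ((0 : ℝ≥0) • a)) = 0 := by
        have h := hf.dirDeriv_update_add hD u i 0 0
        rw [add_zero] at h
        rw [zero_smul]
        exact left_eq_add.1 h
      have h := hD.addMonoidHom_apply_eq_smul
        { toFun := fun t : ℝ≥0 => dirDeriv f (Function.update u i (t • a))
          map_zero' := hzero
          map_add' := fun s t => by rw [add_smul, hf.dirDeriv_update_add hD] } r
      simpa using h)

theorem multilinearDeriv_apply {n : ℕ} (u : Fin n → C) :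
    hf.multilinearDeriv hD n u = dirDeriv f u :=
  rfl

end PreStable

end DirDeriv

/-! ### Derivatives as infima over partitions -/

section Partitions

variable {D : Type*} [AddCommMonoid D] [Module ℝ≥0 D]

theorem multiSum_multilinearMap {C : Type*} [AddCommMonoid C] [Module ℝ≥0 C] {n : ℕ}
    (L : MultilinearMap ℝ≥0 (fun _ : Fin n => C) D)
    (π : Fin n → Multiset C) : multiSum π L = L fun i => (π i).sum := by
  induction n with
  | zero => exact congrArg L (Subsingleton.elim _ _)
  | succ n ih =>
    have h (y : C) : multiSum (Fin.tail π) (fun v => L (Fin.cons y v)) =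
        L.curryLeft y fun i => (π i.succ).sum := ih (L.curryLeft y) (Fin.tail π)
    simp only [multiSum, h]
    -- The first direction is summed by additivity of `L` there, the others being fixed.
    have hcons (y : C) : L.curryLeft y (fun i => (π i.succ).sum) =
        L.toLinearMap (Fin.cons 0 fun i => (π i.succ).sum) 0 y := by
      rw [MultilinearMap.toLinearMap_apply, Fin.update_cons_zero, MultilinearMap.curryLeft_apply]
    simp only [hcons]
    rw [← map_multiset_sum, ← hcons, MultilinearMap.curryLeft_apply]
    exact congrArg L (Fin.cons_self_tail fun i => (π i).sum)

theorem multiSum_replicate {M : Type*} {n : ℕ} (m : ℕ) (y : Fin n → M) (g : (Fin n → M) → D) :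
    multiSum (fun i => Multiset.replicate m (y i)) g = (m : ℝ≥0) ^ n • g y := by
  induction n with
  | zero =>
    rw [pow_zero, one_smul]
    exact congrArg g (Subsingleton.elim _ _)
  | succ n ih =>
    have h := ih (Fin.tail y) fun v => g (Fin.cons (y 0) v)
    rw [Fin.cons_self_tail] at h
    simp only [multiSum, Multiset.map_replicate, Multiset.sum_replicate]
    rw [pow_succ', mul_smul, ← h, Nat.cast_smul_eq_nsmul]
    rfl

theorem multiSum_mono [NormedCone D] {M : Type*} {n : ℕ} {π : Fin n → Multiset M}
    {g h : (Fin n → M) → D}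
    (hgh : ∀ y, (∀ i, y i ∈ π i) → g y ≤ h y) : multiSum π g ≤ multiSum π h := by
  induction n with
  | zero => exact hgh _ fun i => i.elim0
  | succ n ih =>
    refine Multiset.sum_map_le_sum_map _ _ fun a ha => ih fun y hy => hgh _ fun i => ?_
    cases i using Fin.cases with
    | zero => exact ha
    | succ i => exact hy i

end Partitions

section BallDeriv

variable {C D : Type*} [AddCommMonoid C] [Module ℝ≥0 C] [NormedCone C]
  [AddCommMonoid D] [Module ℝ≥0 D] [NormedCone D]

namespace PreStable

variable {f : C → D} (hf : PreStable f) (hD : IsDirectedComplete D)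

include hf hD

/-- The directional derivative is a lower bound because it is multilinear and below the differences,
and it is the greatest one because it is already the infimum over the partitions of each direction
into `2 ^ j` equal parts. No common refinements of partitions are needed. -/
theorem isGLB_dirDeriv {n : ℕ} {u : Fin n → C} (hu : u ∈ localBall n 0) :
    IsGLB (Phi f 0 '' parts u) (dirDeriv f u) := by
  constructor
  · rintro _ ⟨π, hπ, rfl⟩
    have hsum : (fun i => (π i).sum) = u := funext hπ
    rw [← hf.multilinearDeriv_apply hD, ← hsum, ← multiSum_multilinearMap]
    refine multiSum_mono fun y hy => hf.dirDeriv_le_diff hD (localBall_of_le hu ?_)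
    refine add_le_add_right (Finset.sum_le_sum fun i _ => ?_) 0
    rw [← hπ i]
    exact Multiset.single_le_sum (fun _ _ => zero_le) _ (hy i)
  · intro d hd
    rw [(hf.decreasesTo_dirDeriv hD u).le_iff]
    refine .of_forall fun j => hd
      ⟨fun i => Multiset.replicate (2 ^ j) (((2 : ℝ≥0) ^ j)⁻¹ • u i), fun i => ?_, ?_⟩
    · rw [Multiset.sum_replicate, ← Nat.cast_smul_eq_nsmul ℝ≥0, smul_smul, Nat.cast_pow,
        Nat.cast_ofNat, mul_inv_cancel₀ (by positivity), one_smul]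
    · rw [Phi, multiSum_replicate, Nat.cast_pow, Nat.cast_ofNat]
      rfl

theorem ballDeriv_eq {n : ℕ} {u : Fin n → C} (hu : u ∈ localBall n 0) :
    ballDeriv f 0 u = dirDeriv f u :=
  coneInf_eq (hf.isGLB_dirDeriv hD hu)

theorem dirDeriv_smul {n : ℕ} (r : ℝ≥0) (u : Fin n → C) :
    dirDeriv f (r • u) = r ^ n • dirDeriv f u := by
  have h := (hf.multilinearDeriv hD n).map_smul_univ (fun _ => r) u
  rwa [Finset.prod_const, Finset.card_fin] at h

theorem higherDeriv_eq {n : ℕ} (u : Fin n → C) : higherDeriv f 0 u = dirDeriv f u := by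
  have h : ∃ r : ℝ≥0, 0 < r ∧ r • u ∈ localBall n 0 := by
    obtain ⟨j, hj⟩ := (eventually_smul_mem_localBall u).exists
    exact ⟨_, by positivity, hj⟩
  obtain ⟨hpos, hmem⟩ := h.choose_spec
  rw [higherDeriv, dif_pos h, hf.ballDeriv_eq hD hmem, hf.dirDeriv_smul hD, smul_smul,
    inv_mul_cancel₀ (pow_pos hpos n).ne', one_smul]

end PreStable

end BallDeriv

/-! ### Binomial coefficients -/

theorem choose_mul_pow_le_choose_mul_pow {m M : ℕ} (h : m ≤ M) (k : ℕ) :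
    m.choose k * M ^ k ≤ M.choose k * m ^ k := by
  refine Nat.le_of_mul_le_mul_left ?_ k.factorial_pos
  rw [← mul_assoc, ← mul_assoc, ← Nat.descFactorial_eq_factorial_mul_choose,
    ← Nat.descFactorial_eq_factorial_mul_choose]
  induction k with
  | zero => simp
  | succ k ih =>
    have hk : (m - k) * M ≤ (M - k) * m := by
      rw [Nat.sub_mul, Nat.sub_mul, mul_comm M m]
      exact Nat.sub_le_sub_left (Nat.mul_le_mul_left k h) _
    calc m.descFactorial (k + 1) * M ^ (k + 1)
        = ((m - k) * M) * (m.descFactorial k * M ^ k) := by rw [Nat.descFactorial_succ]; ring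
      _ ≤ ((M - k) * m) * (M.descFactorial k * m ^ k) := Nat.mul_le_mul hk ih
      _ = _ := by rw [Nat.descFactorial_succ]; ring

theorem eventually_inv_factorial_le (k : ℕ) {ε : ℝ≥0} (hε : 0 < ε) :
    ∀ᶠ m : ℕ in atTop, (k ! : ℝ≥0)⁻¹ ≤ m.choose k * ((m : ℝ≥0) ^ k)⁻¹ + ε := by
  have h1 : Tendsto (fun n : ℕ => (n : ℝ) * (n : ℝ)⁻¹) atTop (𝓝 1) := by
    refine tendsto_const_nhds.congr' ?_
    filter_upwards [eventually_ge_atTop 1] with n hn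
    rw [mul_inv_cancel₀]
    positivity
  have h2 := ProbabilityTheory.tendsto_choose_mul_pow_atTop k h1
  have hε' : (1 : ℝ) ^ k / (k !) - (ε : ℝ) < 1 ^ k / (k !) :=
    sub_lt_self _ (NNReal.coe_pos.2 hε)
  filter_upwards [h2.eventually_const_lt hε'] with m hm
  rw [← NNReal.coe_le_coe]
  push_cast
  rw [one_pow, one_div, inv_pow] at hm
  linarith

/-! ### The Taylor expansion at `0` -/

section Taylor

theorem two_pow_nsmul_inv_smul {M : Type*} [AddCommMonoid M] [Module ℝ≥0 M] (i : ℕ) (x : M) :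
    2 ^ i • ((2 : ℝ≥0) ^ i)⁻¹ • x = x := by
  rw [← Nat.cast_smul_eq_nsmul ℝ≥0, smul_smul, Nat.cast_pow, Nat.cast_ofNat,
    mul_inv_cancel₀ (by positivity), one_smul]

theorem diff_const_eq_smul_dyadicQuotient {C D : Type*} [AddCommMonoid C] [Module ℝ≥0 C]
    [AddCommMonoid D] [Module ℝ≥0 D] (f : C → D) (x : C) (j k : ℕ) :
    diff f 0 (fun _ : Fin k => ((2 : ℝ≥0) ^ j)⁻¹ • x) =
      (((2 : ℝ≥0) ^ j) ^ k)⁻¹ • dyadicQuotient f (fun _ : Fin k => x) j := by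
  rw [dyadicQuotient, smul_smul, inv_mul_cancel₀ (by positivity), one_smul]
  rfl

variable {C D : Type*} [AddCommMonoid C] [Module ℝ≥0 C] [NormedCone C]
  [AddCommMonoid D] [Module ℝ≥0 D] [NormedCone D]

namespace PreStable

variable {f : C → D} (hf : PreStable f)

include hf

/-- Newton's forward difference formula. -/
theorem diff_nsmul_eq_sum {y : C} (m n : ℕ) (h : cnorm ((m + n) • y) ≤ 1) :
    diff f (m • y) (fun _ : Fin n => y) =
      ∑ k ∈ Finset.range (m + 1), m.choose k • diff f 0 (fun _ : Fin (n + k) => y) := by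
  set e : ℕ → D := fun k => diff f 0 (fun _ : Fin k => y) with he
  change _ = ∑ k ∈ Finset.range (m + 1), m.choose k • e (n + k)
  induction m generalizing n with
  | zero => simp [he]
  | succ m ih =>
    have hcons : (Fin.cons y (fun _ : Fin n => y) : Fin (n + 1) → C) = fun _ => y :=
      funext fun i => by cases i using Fin.cases <;> rfl
    have hmem : (Fin.cons y (fun _ : Fin n => y) : Fin (n + 1) → C) ∈
        localBall (n + 1) (m • y) := by
      rw [hcons]
      simpa [localBall, ← add_smul, add_assoc, add_comm, add_left_comm] using h
    have hrec := hf.diff_add_diff_cons hmem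
    have h1 : cnorm ((m + n) • y) ≤ 1 :=
      (cnorm_mono (nsmul_le_nsmul_left zero_le (by omega))).trans h
    have h2 : cnorm ((m + (n + 1)) • y) ≤ 1 := by rwa [add_comm n 1, ← add_assoc]
    rw [hcons, ih n h1, ih (n + 1) h2, ← succ_nsmul] at hrec
    have htop : ∑ k ∈ Finset.range (m + 1), m.choose k • e (n + k) =
        ∑ k ∈ Finset.range (m + 1), m.choose (k + 1) • e (n + (k + 1)) + e n := by
      have h3 := Finset.sum_range_succ' (fun k => m.choose k • e (n + k)) (m + 1)
      rw [Finset.sum_range_succ, Nat.choose_succ_self, zero_smul, add_zero] at h3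
      simpa using h3
    rw [← hrec, Finset.sum_range_succ' _ (m + 1), htop]
    simp only [Nat.choose_succ_succ', add_smul, Finset.sum_add_distrib, Nat.choose_zero_right,
      one_smul, add_zero, add_right_comm n 1, ← add_assoc n]
    abel

theorem apply_nsmul_eq_sum {y : C} (m : ℕ) (h : cnorm (m • y) ≤ 1) :
    f (m • y) =
      ∑ k ∈ Finset.range (m + 1), (m.choose k : ℝ≥0) • diff f 0 (fun _ : Fin k => y) := by
  have h0 := hf.diff_nsmul_eq_sum (y := y) m 0 h
  rw [diff_fin_zero] at h0
  rw [h0]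
  refine Finset.sum_congr rfl fun k _ => ?_
  rw [Nat.cast_smul_eq_nsmul, zero_add]

variable (hD : IsDirectedComplete D)

include hD

theorem taylorSum_eq (N : ℕ) (x : C) :
    taylorSum f N 0 x =
      ∑ k ∈ Finset.range (N + 1), (k ! : ℝ≥0)⁻¹ • dirDeriv f (fun _ : Fin k => x) := by
  have h0 : dirDeriv f (fun _ : Fin 0 => x) = f 0 := by
    refine (hf.decreasesTo_dirDeriv hD _).unique ((DecreasesTo.const (f 0)).congr (.of_forall ?_))
    intro j
    rw [dyadicQuotient, diff_fin_zero, pow_zero, one_smul]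
  rw [Finset.range_eq_Ico, Finset.sum_eq_sum_Ico_succ_bot (Nat.succ_pos N), h0, taylorSum]
  simp only [hf.higherDeriv_eq hD, Nat.factorial_zero, Nat.cast_one, inv_one, one_smul]
  rfl

theorem taylorSum_le {x : C} (hx : cnorm x ≤ 1) (N : ℕ) : taylorSum f N 0 x ≤ f x := by
  rw [hf.taylorSum_eq hD]
  set a : ℕ → D := fun k => dirDeriv f (fun _ : Fin k => x)
  refine hD.le_of_forall_le_add_smul (R := ∑ k ∈ Finset.range (N + 1), a k) fun ε hε => ?_
  have hpow : Tendsto (fun j : ℕ => 2 ^ j) atTop atTop :=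
    tendsto_pow_atTop_atTop_of_one_lt one_lt_two
  have h1 : ∀ᶠ j : ℕ in atTop, ∀ k ∈ Finset.range (N + 1),
      (k ! : ℝ≥0)⁻¹ ≤ (2 ^ j).choose k * (((2 : ℝ≥0) ^ j) ^ k)⁻¹ + ε :=
    (eventually_all_finset _).2 fun k _ => by
      filter_upwards [hpow.eventually (eventually_inv_factorial_le k hε)] with j hj
      simpa using hj
  have h2 : ∀ᶠ j : ℕ in atTop, ∀ k ∈ Finset.range (N + 1),
      a k ≤ dyadicQuotient f (fun _ : Fin k => x) j :=
    (eventually_all_finset _).2 fun k _ => (hf.decreasesTo_dirDeriv hD _).eventually_le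
  obtain ⟨j, ⟨hj1, hj2⟩, hj3⟩ := ((h1.and h2).and (hpow.eventually_ge_atTop N)).exists
  have hnewton := hf.apply_nsmul_eq_sum (y := ((2 : ℝ≥0) ^ j)⁻¹ • x) (2 ^ j)
    (by rwa [two_pow_nsmul_inv_smul])
  rw [two_pow_nsmul_inv_smul] at hnewton
  calc ∑ k ∈ Finset.range (N + 1), (k ! : ℝ≥0)⁻¹ • a k
      ≤ ∑ k ∈ Finset.range (N + 1),
          (((2 ^ j).choose k * (((2 : ℝ≥0) ^ j) ^ k)⁻¹) • a k + ε • a k) :=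
        Finset.sum_le_sum fun k hk => by
          rw [← add_smul]
          exact smul_le_smul_of_nonneg_right (hj1 k hk) zero_le
    _ = ∑ k ∈ Finset.range (N + 1), ((2 ^ j).choose k * (((2 : ℝ≥0) ^ j) ^ k)⁻¹) • a k +
          ε • ∑ k ∈ Finset.range (N + 1), a k := by
        rw [Finset.sum_add_distrib, Finset.smul_sum]
    _ ≤ ∑ k ∈ Finset.range (N + 1), ((2 ^ j).choose k : ℝ≥0) •
          diff f 0 (fun _ : Fin k => ((2 : ℝ≥0) ^ j)⁻¹ • x) +
          ε • ∑ k ∈ Finset.range (N + 1), a k := by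
        refine add_le_add_left (Finset.sum_le_sum fun k hk => ?_) _
        rw [diff_const_eq_smul_dyadicQuotient, smul_smul]
        exact smul_le_smul_of_nonneg_left (hj2 k hk) zero_le
    _ ≤ f x + ε • ∑ k ∈ Finset.range (N + 1), a k := by
        rw [hnewton]
        refine add_le_add_left (Finset.sum_le_sum_of_subset ?_) _
        exact Finset.range_subset_range.2 (by omega)

/-- The remainder of the Taylor expansion is bounded geometrically. In Newton's formulas for `f` at
`x` and at the larger point `(1 + 2⁻¹ ^ i) • x`, with the same step, the coefficients of the
differences of order `k` have a ratio of at most `(1 + 2⁻¹ ^ i)⁻¹ ^ k`. -/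
theorem apply_le_taylorSum_add {x : C} {i : ℕ}
    (hx : cnorm ((2 ^ i + 1) • ((2 : ℝ≥0) ^ i)⁻¹ • x) ≤ 1) (N : ℕ) :
    f x ≤ taylorSum f N 0 x + ((2 : ℝ≥0) ^ i / (2 ^ i + 1)) ^ (N + 1) •
      f ((2 ^ i + 1) • ((2 : ℝ≥0) ^ i)⁻¹ • x) := by
  set z := (2 ^ i + 1) • ((2 : ℝ≥0) ^ i)⁻¹ • x with hz
  set θ : ℝ≥0 := 2 ^ i / (2 ^ i + 1) with hθ
  have hθ1 : θ ≤ 1 := div_le_one_of_le₀ le_self_add zero_le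
  have hxz : x ≤ z := by
    rw [hz, succ_nsmul, two_pow_nsmul_inv_smul]
    exact le_self_add
  have hx1 : cnorm x ≤ 1 := (cnorm_mono hxz).trans hx
  have hlim := hD.decreasesTo_const_add (θ ^ (N + 1) • f z)
    (hD.decreasesTo_sum (Finset.range (N + 1)) fun k _ =>
      (hf.decreasesTo_dirDeriv hD (fun _ : Fin k => x)).smul (k ! : ℝ≥0)⁻¹)
  rw [hf.taylorSum_eq hD, add_comm, hlim.le_iff]
  filter_upwards [eventually_ge_atTop i] with J hJ
  obtain ⟨j, rfl⟩ := Nat.exists_eq_add_of_le hJ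
  set y := ((2 : ℝ≥0) ^ (i + j))⁻¹ • x with hy
  set m := 2 ^ (i + j) with hm
  set M := (2 ^ i + 1) * 2 ^ j with hM
  have hmM : m ≤ M := by rw [hm, hM, pow_add]; gcongr; omega
  have hMpos : (0 : ℝ≥0) < M := by positivity
  have hmy : m • y = x := two_pow_nsmul_inv_smul _ x
  have hMy : M • y = z := by
    rw [hM, mul_smul, hz, hy, pow_add, mul_inv_rev, mul_smul, two_pow_nsmul_inv_smul]
  have hmMθ : (m : ℝ≥0) = θ * M := by
    rw [hθ, hm, hM]
    push_cast
    rw [pow_add, ← mul_assoc, div_mul_cancel₀ _ (by positivity)]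
  have hchoose (k : ℕ) : (m.choose k : ℝ≥0) ≤ θ ^ k * M.choose k := by
    have h : (m.choose k : ℝ≥0) * M ^ k ≤ M.choose k * m ^ k := by
      exact_mod_cast choose_mul_pow_le_choose_mul_pow hmM k
    rw [hmMθ, mul_pow, ← mul_assoc, mul_comm _ (θ ^ k)] at h
    exact le_of_mul_le_mul_right h (pow_pos hMpos k)
  have hfx := hf.apply_nsmul_eq_sum (y := y) m (by rwa [hmy])
  have hfz := hf.apply_nsmul_eq_sum (y := y) M (by rwa [hMy])
  rw [hmy] at hfx
  rw [hMy] at hfz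
  set e : ℕ → D := fun k => diff f 0 (fun _ : Fin k => y) with he
  have hsplit : Finset.range (m + 1) ⊆ Finset.range (N + 1) ∪ Finset.Ico (N + 1) (M + 1) := by
    intro k hk
    simp only [Finset.mem_union, Finset.mem_range, Finset.mem_Ico] at hk ⊢
    omega
  have hdisj : Disjoint (Finset.range (N + 1)) (Finset.Ico (N + 1) (M + 1)) := by
    rw [Finset.disjoint_left]
    intro k hk hk'
    simp only [Finset.mem_range, Finset.mem_Ico] at hk hk'
    omega
  calc f x = ∑ k ∈ Finset.range (m + 1), (m.choose k : ℝ≥0) • e k := hfx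
    _ ≤ ∑ k ∈ Finset.range (N + 1) ∪ Finset.Ico (N + 1) (M + 1), (m.choose k : ℝ≥0) • e k :=
        Finset.sum_le_sum_of_subset hsplit
    _ = ∑ k ∈ Finset.Ico (N + 1) (M + 1), (m.choose k : ℝ≥0) • e k +
          ∑ k ∈ Finset.range (N + 1), (m.choose k : ℝ≥0) • e k := by
        rw [Finset.sum_union hdisj, add_comm]
    _ ≤ θ ^ (N + 1) • f z + ∑ k ∈ Finset.range (N + 1),
          (k ! : ℝ≥0)⁻¹ • dyadicQuotient f (fun _ : Fin k => x) (i + j) := by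
        refine add_le_add ?_ (Finset.sum_le_sum fun k _ => ?_)
        · rw [hfz, Finset.smul_sum]
          refine (Finset.sum_le_sum fun k hk => ?_).trans (Finset.sum_le_sum_of_subset
            (s := Finset.Ico (N + 1) (M + 1)) fun k hk => ?_)
          · rw [smul_smul]
            refine smul_le_smul_of_nonneg_right ((hchoose k).trans ?_) zero_le
            exact mul_le_mul_left (pow_le_pow_of_le_one zero_le hθ1 (Finset.mem_Ico.1 hk).1) _
          · exact Finset.mem_range.2 (Finset.mem_Ico.1 hk).2
        · simp only [he, hy]
          rw [diff_const_eq_smul_dyadicQuotient, smul_smul]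
          refine smul_le_smul_of_nonneg_right ?_ zero_le
          have h := Nat.choose_le_pow_div (α := ℝ≥0) k m
          rw [hm] at h ⊢
          push_cast at h
          rw [div_eq_mul_inv, mul_comm] at h
          calc ((2 ^ (i + j)).choose k : ℝ≥0) * (((2 : ℝ≥0) ^ (i + j)) ^ k)⁻¹
              ≤ (k ! : ℝ≥0)⁻¹ * ((2 : ℝ≥0) ^ (i + j)) ^ k * (((2 : ℝ≥0) ^ (i + j)) ^ k)⁻¹ :=
                mul_le_mul_left h _
            _ = (k ! : ℝ≥0)⁻¹ := mul_inv_cancel_right₀ (by positivity) _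

/-- **Bernstein's theorem** for pre-stable functions. -/
theorem isLUB_taylorSum {x : C} (hx : cnorm x < 1) :
    IsLUB (Set.range fun N => taylorSum f N 0 x) (f x) := by
  refine ⟨?_, fun d hd => ?_⟩
  · rintro _ ⟨N, rfl⟩
    exact hf.taylorSum_le hD hx.le N
  obtain ⟨i, hi⟩ : ∃ i : ℕ, cnorm ((2 ^ i + 1) • ((2 : ℝ≥0) ^ i)⁻¹ • x) ≤ 1 := by
    have hlim : Tendsto (fun i : ℕ => (1 + ((2 : ℝ≥0) ^ i)⁻¹) * cnorm x) atTop
        (𝓝 ((1 + 0) * cnorm x)) := by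
      exact (tendsto_const_nhds.add tendsto_inv_two_pow).mul_const _
    rw [add_zero, one_mul] at hlim
    obtain ⟨i, hi⟩ := (hlim.eventually_le_const hx).exists
    refine ⟨i, ?_⟩
    rw [← cnorm_smul, add_smul, one_smul] at hi
    rwa [succ_nsmul, two_pow_nsmul_inv_smul]
  refine hD.le_of_forall_le_add_smul (R := f ((2 ^ i + 1) • ((2 : ℝ≥0) ^ i)⁻¹ • x)) fun ε hε => ?_
  have hθ : (2 : ℝ≥0) ^ i / (2 ^ i + 1) < 1 := by
    rw [div_lt_one (by positivity)]
    exact lt_add_one _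
  obtain ⟨N, hN⟩ := exists_pow_lt_of_lt_one hε hθ
  refine (hf.apply_le_taylorSum_add hD hi N).trans (add_le_add (hd ⟨N, rfl⟩) ?_)
  refine smul_le_smul_of_nonneg_right ?_ zero_le
  exact (pow_le_pow_of_le_one zero_le hθ.le N.le_succ).trans hN.le

end PreStable

end Taylor

end NormedCone

theorem mainTheorem1 {C : Type*} {D : Type*}
    [AddCommMonoid C] [Module ℝ≥0 C] [NormedCone C]
    [AddCommMonoid D] [Module ℝ≥0 D] [NormedCone D]
    (hC : NormedCone.IsDirectedComplete C) (hC' : NormedCone.IsLattice C)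
    (hD : NormedCone.IsDirectedComplete D) (hD' : NormedCone.IsLattice D)
    (f : C → D) (hf : NormedCone.PreStable f) :
    -- the infima defining the derivatives at `0` exist
    (∀ (n : ℕ) (u : Fin n → C), u ∈ NormedCone.localBall n 0 →
      IsGLB (NormedCone.Phi f 0 '' NormedCone.parts u) (NormedCone.ballDeriv f 0 u)) ∧
    -- their homogeneous extension does not depend on the rescaling
    (∀ (n : ℕ) (u : Fin n → C) (r : ℝ≥0), 0 < r → r • u ∈ NormedCone.localBall n 0 →
      NormedCone.ballDeriv f 0 (r • u) = r ^ n • NormedCone.higherDeriv f 0 u) ∧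
    -- on the open unit ball, the Taylor series at `0` is a well-defined supremum, equal to `f`
    (∀ x : C, NormedCone.cnorm x < 1 →
      IsLUB (Set.range fun N => NormedCone.taylorSum f N 0 x) (NormedCone.taylorSeries f 0 x) ∧
      f x = NormedCone.taylorSeries f 0 x) := by
  refine ⟨fun n u hu => ?_, fun n u r _ hu => ?_, fun x hx => ?_⟩
  · rw [hf.ballDeriv_eq hD hu]
    exact hf.isGLB_dirDeriv hD hu
  · rw [hf.ballDeriv_eq hD hu, hf.dirDeriv_smul hD, hf.higherDeriv_eq hD]
  · have h := hf.isLUB_taylorSum hD hx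
    rw [NormedCone.taylorSeries, NormedCone.coneSup_eq h]
    exact ⟨h, rfl⟩
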